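/- Let $G$ be a finite group and $N$ a normal subgroup of $G$. Let $\Gamma_G(N)$ be the graph whose vertices are the $G$-conjugacy classes contained in $N$ of cardinality greater than $1$, two distinct vertices being joined by an edge if and only if their cardinalities are not coprime. Suppose that $\Gamma_G(N)$ has exactly three vertices and exactly one edge. Then there are two distinct primes $p$ and $q$ such that $N$ is a $\{p,q\}$-group (every prime dividing $|N|$ is $p$ or $q$) and at least one of the following holds: 1. $N$ is a $p$-group; 2. $N$ is a quasi-Frobenius group with abelian kernel and abelian complement, and $|N\cap \mathbf{Z}(G)|$ is $1$ or $2$. Here a finite group $N$ is called quasi-Frobenius if $N/\mathbf{Z}(N)$ is a Frobenius group; the kernel and the complement of $N$ are then the preimages in $N$ of the Frobenius kernel and of a Frobenius complement of $N/\mathbf{Z}(N)$. -/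

import Mathlib

/-- The graph `Γ_G(N)`: its vertices are the `G`-conjugacy classes contained in `N` of cardinality
bigger than one, and two distinct vertices are adjacent when their sizes are not coprime. -/
def classGraph {G : Type*} [Group G] (N : Subgroup G) :
    SimpleGraph {C : ConjClasses G // C.carrier ⊆ (N : Set G) ∧ 1 < C.carrier.ncard} where
  Adj C D := C ≠ D ∧ ¬ Nat.Coprime C.1.carrier.ncard D.1.carrier.ncard
  symm := ⟨fun _ _ h => ⟨h.1.symm, fun hc => h.2 hc.symm⟩⟩
  loopless := ⟨fun _ h => h.1 rfl⟩

/-- The finite group `G` is a Frobenius group with kernel `K` and complement `H`: `G` is the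
semidirect product of the nontrivial normal subgroup `K` and the nontrivial subgroup `H`, and no
nontrivial element of `H` centralizes a nontrivial element of `K`. -/
structure IsFrobeniusWith {G : Type*} [Group G] (K H : Subgroup G) : Prop where
  normal : K.Normal
  kernel_ne_bot : K ≠ ⊥
  complement_ne_bot : H ≠ ⊥
  isComplement : Subgroup.IsComplement' K H
  fixedPointFree : ∀ h ∈ H, h ≠ 1 → ∀ k ∈ K, k ≠ 1 → h * k * h⁻¹ ≠ k

/-- The finite group `G` is quasi-Frobenius with kernel `K` and complement `H`: the quotient of `G`
by its centre is a Frobenius group, and `K` and `H` are the preimages in `G` of its kernel and of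
its complement. -/
def IsQuasiFrobeniusWith {G : Type*} [Group G] (K H : Subgroup G) : Prop :=
  ∃ K' H' : Subgroup (G ⧸ Subgroup.center G), IsFrobeniusWith K' H' ∧
    K = K'.comap (QuotientGroup.mk' (Subgroup.center G)) ∧
    H = H'.comap (QuotientGroup.mk' (Subgroup.center G))

/-! The third vertex is isolated: it is the class of some `w` in `N`, its size is coprime to the
other two noncentral sizes, and only those two other classes exist. Nothing else about the graph is
used.

Suppose `t ≠ 1` in `N` is central in `G`. Then `t * w` has the class size of `w`, so it is conjugate
to `w`, while `u` and `t * u` are not conjugate for noncentral `u` in `N` outside the class of `w`.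
Thus `u`, `t * u`, `w` exhaust the classes, which makes `t` unique, of order 2. An element `x` of
odd prime order commutes with a noncentral 2-element `s`, and `x * s` would lie in a fourth class;
so `N` is a 2-group (`isPGroup_two`).

Suppose `N` meets the centre trivially. Nontrivial commuting `x`, `y` of coprime orders would again
give a fourth class `x * y` (`not_commute`), so centralizers in `N` of nontrivial elements have
prime power order. Coprimality with the class of `w` leaves at most two primes and, when there are
two, makes these centralizers full Sylow subgroups. Counting elements in the centres of the Sylow
subgroups then gives an abelian self-normalizing Sylow subgroup, and Burnside's transfer theorem
supplies the Frobenius kernel (`exists_isFrobeniusWith`). -/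

/-- A finite group all of whose prime divisors equal `p` is a `p`-group. -/
theorem isPGroup_of_forall_prime_dvd_card {M : Type*} [Group M] [Finite M] {p : ℕ}
    (h : ∀ r : ℕ, r.Prime → r ∣ Nat.card M → r = p) : IsPGroup p M :=
  IsPGroup.of_card (Nat.eq_prime_pow_of_unique_prime_dvd Nat.card_pos.ne' fun hr hd => h _ hr hd)

theorem exists_orderOf_pow_eq_of_prime_dvd {M : Type*} [Group M] [Finite M] {x : M} {r : ℕ}
    (hr : r.Prime) (h : r ∣ orderOf x) : ∃ k : ℕ, orderOf (x ^ k) = r := by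
  refine ⟨orderOf x / r, ?_⟩
  rw [orderOf_pow_of_dvd (Nat.div_pos (Nat.le_of_dvd (orderOf_pos x) h) hr.pos).ne'
    (Nat.div_dvd_of_dvd h), Nat.div_div_self h (orderOf_pos x).ne']

/-! ### Frobenius groups from centralizers that are Sylow subgroups -/

/-- The elements whose centralizer is a Sylow `p`-subgroup are covered by the centers of the
Sylow `p`-subgroups. -/
theorem card_centralizer_eq_le {M : Type*} [Group M] [Finite M] {p n : ℕ} [Fact p.Prime]
    (hn : n = p ^ (Nat.card M).factorization p) (P : Sylow p M) :
    {x : M | x ≠ 1 ∧ Nat.card (Subgroup.centralizer {x}) = n}.ncard + Nat.card (Sylow p M) ≤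
      Nat.card (Sylow p M) * Nat.card (Subgroup.center P) := by
  have := Fintype.ofFinite (Sylow p M)
  have hcard : ∀ Q : Sylow p M, Nat.card (Subgroup.center Q) = Nat.card (Subgroup.center P) :=
    fun Q => Nat.card_congr (Subgroup.centerCongr (Q.equiv P)).toEquiv
  have hfun : ∀ x : {x : M | x ≠ 1 ∧ Nat.card (Subgroup.centralizer {x}) = n},
      ∃ s : Σ Q : Sylow p M, Subgroup.center Q, ((s.2 : s.1) : M) = x := by
    rintro ⟨x, hx1, hx⟩
    let Q : Sylow p M := Sylow.ofCard (Subgroup.centralizer {x}) (by rw [hx, hn])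
    have hQ : (Q : Subgroup M) = Subgroup.centralizer {x} := Sylow.coe_ofCard _ _
    have hxQ : x ∈ Q := by
      change x ∈ (Q : Subgroup M)
      rw [hQ, Subgroup.mem_centralizer_singleton_iff]
    refine ⟨⟨Q, ⟨⟨x, hxQ⟩, Subgroup.mem_center_iff.2 ?_⟩⟩, rfl⟩
    rintro ⟨g, hg⟩
    have hg' : g ∈ (Q : Subgroup M) := hg
    rw [hQ, Subgroup.mem_centralizer_singleton_iff] at hg'
    exact Subtype.ext hg'
  choose f hf using hfun
  -- The identity of each centre is missed by `f`; it accounts for the extra summand on the left.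
  have hinj : Function.Injective (Sum.elim f fun Q : Sylow p M => ⟨Q, 1⟩) := by
    refine Function.Injective.sumElim (fun x y h => ?_) (fun Q R h => congrArg Sigma.fst h)
      (fun x Q h => ?_)
    · exact Subtype.ext (by rw [← hf x, ← hf y, h])
    · apply x.2.1
      rw [← hf x, h]
      rfl
  have := Nat.card_le_card_of_injective _ hinj
  rwa [Nat.card_sum, Nat.card_sigma, Nat.card_coe_set_eq, Finset.sum_congr rfl fun Q _ => hcard Q,
    Finset.sum_const, smul_eq_mul, Finset.card_univ, ← Nat.card_eq_fintype_card] at this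

theorem card_sylow_mul_card_center_dvd {M : Type*} [Group M] [Finite M] {p : ℕ} [Fact p.Prime]
    (P : Sylow p M) : Nat.card (Sylow p M) * Nat.card (Subgroup.center P) ∣ Nat.card M := by
  rw [← (P : Subgroup M).index_mul_card]
  exact mul_dvd_mul P.card_dvd_index (Subgroup.card_subgroup_dvd_card _)

/-- If the centralizer of every nontrivial element is a Sylow `p`-subgroup or a Sylow
`q`-subgroup, then an abelian self-normalizing Sylow `q`-subgroup is a Frobenius complement with
abelian kernel. -/
theorem isFrobeniusWith_of_centralizers {M : Type*} [Group M] [Finite M] {p q a b : ℕ}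
    (hp : p.Prime) (hq : q.Prime) (hpq : p ≠ q) (ha : a ≠ 0) (hb : b ≠ 0)
    (hM : Nat.card M = p ^ a * q ^ b)
    (h : ∀ x : M, x ≠ 1 → Nat.card (Subgroup.centralizer {x}) = p ^ a ∨
      Nat.card (Subgroup.centralizer {x}) = q ^ b)
    (Q : Sylow q M) (hQcard : Nat.card Q = q ^ b)
    (hQ : Nat.card (Sylow q M) * Nat.card (Subgroup.center Q) = Nat.card M) :
    ∃ K H : Subgroup M, IsFrobeniusWith K H ∧ IsMulCommutative K ∧ IsMulCommutative H := by
  have := Fact.mk hp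
  have := Fact.mk hq
  have hindex : (Q : Subgroup M).index * Nat.card Q = Nat.card M := (Q : Subgroup M).index_mul_card
  have h1 : Nat.card (Sylow q M) ≤ (Q : Subgroup M).index :=
    Nat.le_of_dvd (Nat.pos_of_ne_zero (Subgroup.index_ne_zero_of_finite)) Q.card_dvd_index
  have h2 : Nat.card (Subgroup.center Q) ≤ Nat.card Q := Subgroup.card_le_card_group _
  have hpos1 : 0 < Nat.card (Sylow q M) := Nat.card_pos
  have hpos2 : 0 < Nat.card Q := Nat.card_pos
  -- The product attains the bound `index * card`, so both factors are maximal: `Q` is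
  -- self-normalizing and abelian.
  have e1 : Nat.card (Sylow q M) = (Q : Subgroup M).index := by
    by_contra hne
    have : Nat.card (Sylow q M) < (Q : Subgroup M).index := lt_of_le_of_ne h1 hne
    nlinarith
  have e2 : Nat.card (Subgroup.center Q) = Nat.card Q := by
    rw [e1, ← hindex] at hQ
    exact Nat.eq_of_mul_eq_mul_left (Nat.pos_of_ne_zero (Subgroup.index_ne_zero_of_finite)) hQ
  have hQcomm : IsMulCommutative (Q : Subgroup M) :=
    Subgroup.center_eq_top_iff.1 (Subgroup.eq_top_of_card_eq _ e2)
  have hnorm : Subgroup.normalizer (Q : Set M) = (Q : Subgroup M) := by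
    refine (Subgroup.eq_of_le_of_card_ge Subgroup.le_normalizer ?_).symm
    have e3 := Q.card_eq_index_normalizer
    have e4 := (Subgroup.normalizer (Q : Set M)).index_mul_card
    rw [← e3, e1, ← hindex] at e4
    exact (Nat.eq_of_mul_eq_mul_left (Nat.pos_of_ne_zero Subgroup.index_ne_zero_of_finite) e4).le
  -- This is the hypothesis of Burnside's transfer theorem; the transfer kernel is the normal
  -- complement.
  have hle : Subgroup.normalizer (Q : Set M) ≤ Subgroup.centralizer (Q : Set M) := by
    rw [hnorm]
    exact Subgroup.le_centralizer (Q : Subgroup M)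
  have hcompl := MonoidHom.ker_transferSylow_isComplement' Q hle
  set K := (MonoidHom.transferSylow Q hle).ker with hK
  have hKcard : Nat.card K = p ^ a := by
    have := hcompl.card_mul_card
    rw [hM, hQcard] at this
    exact Nat.eq_of_mul_eq_mul_right (pow_pos hq.pos b) this
  have hcop : (p ^ a).Coprime (q ^ b) := Nat.Coprime.pow _ _ ((Nat.coprime_primes hp hq).2 hpq)
  have hfact : (Nat.card M).factorization p = a := by
    rw [hM, Nat.factorization_mul (pow_pos hp.pos a).ne' (pow_pos hq.pos b).ne']
    simp [hp.factorization, hq.factorization, hpq.symm]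
  have hcent : ∀ k ∈ K, k ≠ 1 → Subgroup.centralizer {k} = K := by
    intro k hk hk1
    have hkc : k ∈ Subgroup.centralizer {k} := Subgroup.mem_centralizer_singleton_iff.2 rfl
    have ho : orderOf k ∣ p ^ a := hKcard ▸ Subgroup.orderOf_dvd_natCard K hk
    rcases h k hk1 with hc | hc
    · let P : Sylow p M := Sylow.ofCard (Subgroup.centralizer {k}) (by rw [hc, hfact])
      have hP : (P : Subgroup M) = Subgroup.centralizer {k} := Sylow.coe_ofCard _ _
      -- A normal `p`-subgroup lies in every Sylow `p`-subgroup, and the orders agree.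
      have hKP : K ≤ P := IsPGroup.le_sylow_of_normal (IsPGroup.of_card hKcard) P
      rw [← hP]
      refine (Subgroup.eq_of_le_of_card_ge hKP ?_).symm
      rw [hKcard, ← hc, ← hP]
    · exact absurd (orderOf_eq_one_iff.1 (Nat.eq_one_of_dvd_coprimes hcop ho
        (hc ▸ Subgroup.orderOf_dvd_natCard _ hkc))) hk1
  refine ⟨K, Q, ⟨inferInstance, ?_, ?_, hcompl, ?_⟩, ?_, hQcomm⟩
  · intro hbot
    rw [hbot, Subgroup.card_bot] at hKcard
    exact (Nat.one_lt_pow ha hp.one_lt).ne hKcard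
  · intro hbot
    have hc : Nat.card (Q : Subgroup M) = q ^ b := hQcard
    rw [hbot, Subgroup.card_bot] at hc
    exact (Nat.one_lt_pow hb hq.one_lt).ne hc
  · intro g hg hg1 k hk hk1 hgk
    have : g ∈ Subgroup.centralizer {k} :=
      Subgroup.mem_centralizer_singleton_iff.2 (by rwa [mul_inv_eq_iff_eq_mul] at hgk)
    rw [hcent k hk hk1] at this
    exact hg1 (Subgroup.disjoint_def.1 hcompl.disjoint this hg)
  · refine ⟨⟨fun x y => ?_⟩⟩
    by_cases hy : (y : M) = 1
    · have : y = 1 := Subtype.ext hy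
      rw [this, one_mul, mul_one]
    · have hx : (x : M) ∈ Subgroup.centralizer {(y : M)} := by
        rw [hcent y y.2 hy]
        exact x.2
      exact Subtype.ext (Subgroup.mem_centralizer_singleton_iff.1 hx)

/-- If the centralizer of every nontrivial element is a Sylow `p`-subgroup or a Sylow
`q`-subgroup, then the group is a Frobenius group with abelian kernel and complement. -/
theorem exists_isFrobeniusWith {M : Type*} [Group M] [Finite M] {p q a b : ℕ}
    (hp : p.Prime) (hq : q.Prime) (hpq : p ≠ q) (ha : a ≠ 0) (hb : b ≠ 0)
    (hM : Nat.card M = p ^ a * q ^ b)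
    (h : ∀ x : M, x ≠ 1 → Nat.card (Subgroup.centralizer {x}) = p ^ a ∨
      Nat.card (Subgroup.centralizer {x}) = q ^ b) :
    ∃ K H : Subgroup M, IsFrobeniusWith K H ∧ IsMulCommutative K ∧ IsMulCommutative H := by
  have := Fact.mk hp
  have := Fact.mk hq
  have hfp : (Nat.card M).factorization p = a := by
    rw [hM, Nat.factorization_mul (pow_pos hp.pos a).ne' (pow_pos hq.pos b).ne']
    simp [hp.factorization, hq.factorization, hpq.symm]
  have hfq : (Nat.card M).factorization q = b := by
    rw [hM, Nat.factorization_mul (pow_pos hp.pos a).ne' (pow_pos hq.pos b).ne']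
    simp [hp.factorization, hq.factorization, hpq]
  obtain ⟨P⟩ : Nonempty (Sylow p M) := inferInstance
  obtain ⟨Q⟩ : Nonempty (Sylow q M) := inferInstance
  have hPc : Nat.card P = p ^ a := by rw [P.card_eq_multiplicity, hfp]
  have hQc : Nat.card Q = q ^ b := by rw [Q.card_eq_multiplicity, hfq]
  by_cases hQ : Nat.card (Sylow q M) * Nat.card (Subgroup.center Q) = Nat.card M
  · exact isFrobeniusWith_of_centralizers hp hq hpq ha hb hM h Q hQc hQ
  by_cases hP : Nat.card (Sylow p M) * Nat.card (Subgroup.center P) = Nat.card M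
  · exact isFrobeniusWith_of_centralizers hq hp hpq.symm hb ha (hM.trans (mul_comm _ _))
      (fun x hx => (h x hx).symm) P hPc hP
  exfalso
  have half : ∀ m, m ∣ Nat.card M → m ≠ Nat.card M → 2 * m ≤ Nat.card M := by
    rintro m ⟨k, hk⟩ hne
    rw [hk] at hne ⊢
    have hpos : 0 < m * k := hk ▸ Nat.card_pos
    have : 2 ≤ k := by
      rcases k with _ | _ | k
      · simp at hpos
      · simp at hne
      · omega
    rw [mul_comm]
    exact Nat.mul_le_mul_left m this
  have h1 := half _ (card_sylow_mul_card_center_dvd P) hP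
  have h2 := half _ (card_sylow_mul_card_center_dvd Q) hQ
  have h3 := card_centralizer_eq_le (n := p ^ a) (by rw [hfp]) P
  have h4 := card_centralizer_eq_le (n := q ^ b) (by rw [hfq]) Q
  have h5 : 0 < Nat.card (Sylow p M) := Nat.card_pos
  have h6 : 0 < Nat.card (Sylow q M) := Nat.card_pos
  have h7 : Nat.card M ≤ 1 + {x : M | x ≠ 1 ∧ Nat.card (Subgroup.centralizer {x}) = p ^ a}.ncard +
      {x : M | x ≠ 1 ∧ Nat.card (Subgroup.centralizer {x}) = q ^ b}.ncard := by
    rw [← Set.ncard_univ, ← Set.ncard_singleton (1 : M)]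
    refine le_trans (Set.ncard_le_ncard (t := ({1} ∪ _) ∪ _) (fun x _ => ?_) (Set.toFinite _))
      ((Set.ncard_union_le _ _).trans (Nat.add_le_add_right (Set.ncard_union_le _ _) _))
    by_cases hx : x = 1
    · exact Or.inl (Or.inl hx)
    · rcases h x hx with hc | hc
      · exact Or.inl (Or.inr ⟨hx, hc⟩)
      · exact Or.inr ⟨hx, hc⟩
  -- If both products are proper divisors of `|M|`, each is at most `|M| / 2`, so the count gives
  -- `|M| ≤ 1 + |M| - 2`, since there is at least one Sylow subgroup for each prime.
  omega

/-- A Frobenius group with trivial center is quasi-Frobenius. -/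
theorem IsFrobeniusWith.isQuasiFrobeniusWith {M : Type*} [Group M] {K H : Subgroup M}
    (h : IsFrobeniusWith K H) (hZ : Subgroup.center M = ⊥) : IsQuasiFrobeniusWith K H := by
  let π := QuotientGroup.mk' (Subgroup.center M)
  have hπ : Function.Injective π := by
    rw [← MonoidHom.ker_eq_bot_iff, QuotientGroup.ker_mk', hZ]
  have hs : Function.Surjective π := QuotientGroup.mk'_surjective _
  refine ⟨K.map π, H.map π, ⟨h.normal.map π hs, ?_, ?_, ?_, ?_⟩,
    (Subgroup.comap_map_eq_self_of_injective hπ K).symm,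
    (Subgroup.comap_map_eq_self_of_injective hπ H).symm⟩
  · exact fun hb => h.kernel_ne_bot ((Subgroup.map_eq_bot_iff_of_injective K hπ).1 hb)
  · exact fun hb => h.complement_ne_bot ((Subgroup.map_eq_bot_iff_of_injective H hπ).1 hb)
  · refine Subgroup.isComplement'_of_disjoint_and_mul_eq_univ ?_ ?_
    · rw [Subgroup.disjoint_def]
      rintro _ ⟨k, hk, rfl⟩ ⟨g, hg, hgk⟩
      rw [hπ hgk] at hg
      rw [Subgroup.disjoint_def.1 h.isComplement.disjoint hk hg, map_one]
    · rw [Set.eq_univ_iff_forall]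
      intro y
      obtain ⟨x, rfl⟩ := hs y
      obtain ⟨⟨k, g⟩, hkg⟩ := h.isComplement.2 x
      exact ⟨π k, ⟨k, k.2, rfl⟩, π g, ⟨g, g.2, rfl⟩, (map_mul π _ _).symm.trans (congrArg π hkg)⟩
  · rintro _ ⟨g, hg, rfl⟩ hg1 _ ⟨k, hk, rfl⟩ hk1 hgk
    rw [← map_inv, ← map_mul, ← map_mul] at hgk
    exact h.fixedPointFree g hg (fun e => hg1 (by rw [e, map_one])) k hk
      (fun e => hk1 (by rw [e, map_one])) (hπ hgk)

/-! ### Class sizes, central translations and coprime products -/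

theorem ConjClasses.ncard_carrier_mk {G : Type*} [Group G] (x : G) :
    (ConjClasses.mk x).carrier.ncard = (Subgroup.centralizer {x}).index := by
  rw [← ConjAct.orbit_eq_carrier_conjClasses, ← MulAction.index_stabilizer,
    Subgroup.centralizer_eq_comap_stabilizer]
  exact (Subgroup.index_comap_of_surjective _ ConjAct.toConjAct.surjective).symm

theorem Subgroup.index_centralizer_singleton_eq_of_isConj {G : Type*} [Group G] {x y : G}
    (h : IsConj x y) : (centralizer {x}).index = (centralizer {y}).index := by
  rw [← ConjClasses.ncard_carrier_mk, ← ConjClasses.ncard_carrier_mk,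
    ConjClasses.mk_eq_mk_iff_isConj.2 h]

theorem Subgroup.index_centralizer_singleton_eq_one_iff {G : Type*} [Group G] {x : G} :
    (centralizer {x}).index = 1 ↔ x ∈ center G := by
  rw [index_eq_one, eq_top_iff, mem_center_iff]
  exact ⟨fun h g => mem_centralizer_singleton_iff.1 (h (mem_top g)),
    fun h g _ => mem_centralizer_singleton_iff.2 (h g)⟩

theorem Subgroup.centralizer_singleton_mul_of_mem_center {G : Type*} [Group G] {t : G}
    (ht : t ∈ center G) (x : G) : centralizer {t * x} = centralizer {x} := by
  ext g
  rw [mem_centralizer_singleton_iff, mem_centralizer_singleton_iff, ← mul_assoc,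
    mem_center_iff.1 ht g, mul_assoc, mul_assoc, mul_right_inj]

theorem Subgroup.mul_notMem_center {G : Type*} [Group G] {t u : G} (ht : t ∈ center G)
    (hu : u ∉ center G) :
    t * u ∉ center G := fun hcon => hu ((Subgroup.mul_mem_cancel_left _ ht).1 hcon)

theorem IsConj.mul_left_of_mem_center {G : Type*} [Group G] {t : G} (ht : t ∈ Subgroup.center G)
    {x y : G} (h : IsConj x y) : IsConj (t * x) (t * y) := by
  obtain ⟨g, rfl⟩ := isConj_iff.1 h
  refine isConj_iff.2 ⟨g, ?_⟩
  rw [← mul_assoc g t, Subgroup.mem_center_iff.1 ht g]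
  simp only [mul_assoc]

theorem IsConj.pow_mul_of_mem_center {G : Type*} [Group G] {t : G} (ht : t ∈ Subgroup.center G)
    {x : G} (h : IsConj x (t * x)) (n : ℕ) : IsConj x (t ^ n * x) := by
  induction n with
  | zero => rw [pow_zero, one_mul]
  | succ n ih =>
    rw [pow_succ', mul_assoc]
    exact h.trans (ih.mul_left_of_mem_center ht)

theorem IsConj.pow_mem_center {G : Type*} [Group G] {x y : G} (h : IsConj x y) {n : ℕ}
    (hy : y ^ n ∈ Subgroup.center G) : x ^ n ∈ Subgroup.center G := by
  obtain ⟨g, rfl⟩ := isConj_iff.1 h.symm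
  rw [conj_pow]
  exact Subgroup.Normal.conj_mem inferInstance _ hy g

theorem IsConj.mem_of_normal {G : Type*} [Group G] {N : Subgroup G} (hN : N.Normal) {x y : G}
    (h : IsConj x y) (hx : x ∈ N) : y ∈ N := by
  obtain ⟨g, rfl⟩ := isConj_iff.1 h
  exact hN.conj_mem _ hx g

theorem IsConj.orderOf_eq {G : Type*} [Group G] {x y : G} (h : IsConj x y) :
    orderOf x = orderOf y := by
  obtain ⟨g, rfl⟩ := isConj_iff.1 h
  exact (orderOf_injective (MulAut.conj g).toMonoidHom (MulAut.conj g).injective x).symm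

/-- If a conjugacy class is stable under multiplication by a central element of prime order `r`,
then `r` divides its size. -/
theorem dvd_index_centralizer_of_isConj_mul {G : Type*} [Group G] [Finite G] {t x : G}
    (ht : t ∈ Subgroup.center G) (hr : (orderOf t).Prime) (h : IsConj x (t * x)) :
    orderOf t ∣ (Subgroup.centralizer {x}).index := by
  have := Fact.mk hr
  have hpow : ∀ s ∈ Subgroup.zpowers t, IsConj x (s * x) := by
    intro s hs
    obtain ⟨n, rfl⟩ := mem_powers_iff_mem_zpowers.2 hs
    exact h.pow_mul_of_mem_center ht n
  have hcenter : Subgroup.zpowers t ≤ Subgroup.center G := by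
    rwa [Subgroup.zpowers_le]
  -- Left multiplication by `t ≠ 1` has no fixed point, so the class size is 0 modulo `orderOf t`.
  let _ : MulAction (Subgroup.zpowers t) (ConjClasses.mk x).carrier :=
    { smul := fun s v => ⟨s * v, by
        have hv := ConjClasses.mk_eq_mk_iff_isConj.1 (ConjClasses.mem_carrier_iff_mk_eq.1 v.2)
        exact ConjClasses.mem_carrier_iff_mk_eq.2 (ConjClasses.mk_eq_mk_iff_isConj.2
          ((hv.mul_left_of_mem_center (hcenter s.2)).trans (hpow s s.2).symm))⟩
      one_smul := fun v => Subtype.ext (one_mul _)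
      mul_smul := fun s s' v => Subtype.ext (mul_assoc _ _ _) }
  have hp : IsPGroup (orderOf t) (Subgroup.zpowers t) :=
    IsPGroup.of_card (n := 1) (by rw [Nat.card_zpowers, pow_one])
  have hmod := hp.card_modEq_card_fixedPoints (ConjClasses.mk x).carrier
  have hempty : IsEmpty (MulAction.fixedPoints (Subgroup.zpowers t) (ConjClasses.mk x).carrier) := by
    refine ⟨fun v => ?_⟩
    have hv := congrArg Subtype.val (v.2 ⟨t, Subgroup.mem_zpowers t⟩)
    have ht1 : t = 1 := mul_eq_right.1 hv
    rw [ht1, orderOf_one] at hr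
    exact Nat.not_prime_one hr
  rw [Nat.card_coe_set_eq, ConjClasses.ncard_carrier_mk, Nat.card_of_isEmpty] at hmod
  exact (Nat.modEq_zero_iff_dvd).1 hmod

/-- The `r`-group generated by `s` fixes a coset of `H`, because the number of cosets is prime to
`r`. -/
theorem exists_conj_mem_of_not_dvd_index {G : Type*} [Group G] [Finite G] {r k : ℕ}
    (hr : r.Prime) {H : Subgroup G} (hH : ¬ r ∣ H.index) {s : G} (hs : s ^ r ^ k = 1) :
    ∃ g : G, g * s * g⁻¹ ∈ H := by
  have := Fact.mk hr
  obtain ⟨j, -, hj⟩ := (Nat.dvd_prime_pow hr).1 (orderOf_dvd_of_pow_eq_one hs)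
  have hp : IsPGroup r (Subgroup.zpowers s) := IsPGroup.of_card (n := j) (by rw [Nat.card_zpowers, hj])
  obtain ⟨v, hv⟩ := hp.nonempty_fixed_point_of_prime_not_dvd_card (G ⧸ H) hH
  obtain ⟨g, rfl⟩ := QuotientGroup.mk_surjective v
  have h : ((s * g : G) : G ⧸ H) = (g : G ⧸ H) := hv ⟨s, Subgroup.mem_zpowers s⟩
  refine ⟨g⁻¹, ?_⟩
  rw [inv_inv, mul_assoc]
  exact QuotientGroup.eq.1 h.symm

/-- By coprimality `x` is a power of `x * y`. -/
theorem centralizer_mul_le_of_coprime {G : Type*} [Group G] {x y : G} (h : Commute x y)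
    (hxy : (orderOf x).Coprime (orderOf y)) :
    Subgroup.centralizer {x * y} ≤ Subgroup.centralizer {x} := by
  obtain ⟨m, hm⟩ := exists_pow_eq_self_of_coprime hxy.symm
  have hx : (x * y) ^ (orderOf y * m) = x := by
    rw [pow_mul, h.mul_pow, pow_orderOf_eq_one, mul_one, hm]
  intro g hg
  rw [Subgroup.mem_centralizer_singleton_iff] at hg ⊢
  have hc : Commute g (x * y) := hg
  have := hc.pow_right (orderOf y * m)
  rwa [hx] at this

/-- With `H` the centralizer in `G`, the quotient of the two indices is the index of `H ⊔ N`. -/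
theorem index_centralizer_coe_dvd {G : Type*} [Group G] [Finite G] {N : Subgroup G}
    (hN : N.Normal) (x : N) :
    (Subgroup.centralizer {x}).index ∣ (Subgroup.centralizer {(x : G)}).index := by
  set H := Subgroup.centralizer {(x : G)} with hH
  have h1 : Subgroup.centralizer {x} = H.subgroupOf N := by
    ext g
    rw [Subgroup.mem_subgroupOf, hH, Subgroup.mem_centralizer_singleton_iff,
      Subgroup.mem_centralizer_singleton_iff, Subtype.ext_iff]
    rfl
  have h2 : (Subgroup.centralizer {x}).index = H.relIndex N := by rw [h1]; rfl
  have hmul : ∀ {A B : Subgroup G}, A ≤ B → Nat.card A * A.relIndex B = Nat.card B := by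
    intro A B hAB
    have := Subgroup.relIndex_mul_relIndex ⊥ A B bot_le hAB
    rwa [Subgroup.relIndex_bot_left, Subgroup.relIndex_bot_left] at this
  have e1 : Nat.card (H ⊓ N : Subgroup G) * N.relIndex H = Nat.card H := by
    rw [← Subgroup.inf_relIndex_left]
    exact hmul inf_le_left
  have e2 : Nat.card (H ⊓ N : Subgroup G) * H.relIndex N = Nat.card N := by
    rw [← Subgroup.inf_relIndex_right]
    exact hmul inf_le_right
  have e3 : Nat.card N * N.relIndex H = Nat.card (H ⊔ N : Subgroup G) := by
    rw [← Subgroup.relIndex_sup_right]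
    exact hmul le_sup_right
  have e4 := Subgroup.card_mul_index (H ⊔ N)
  have e5 := Subgroup.card_mul_index H
  refine h2 ▸ ⟨(H ⊔ N).index, ?_⟩
  refine Nat.eq_of_mul_eq_mul_left (Nat.card_pos (α := H)) ?_
  rw [e5, ← e4, ← e3, ← e2]
  conv_rhs => rw [← e1]
  ring

/-! ### The isolated class -/

/-- The noncentral element `w` of `N` represents a `G`-class whose size is coprime to those of all
other noncentral classes in `N`, and there are exactly two of the latter. -/
structure IsIsolatedElement {G : Type*} [Group G] (N : Subgroup G) (w : G) : Prop where
  mem : w ∈ N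
  notMem_center : w ∉ Subgroup.center G
  exists_not_isConj : ∃ u ∈ N, u ∉ Subgroup.center G ∧ ¬ IsConj u w
  coprime : ∀ x ∈ N, x ∉ Subgroup.center G → ¬ IsConj x w →
    (Subgroup.centralizer {x}).index.Coprime (Subgroup.centralizer {w}).index
  isConj_or : ∀ x ∈ N, x ∉ Subgroup.center G → ∀ y ∈ N, y ∉ Subgroup.center G →
    ¬ IsConj x y → ¬ IsConj x w → ¬ IsConj y w →
    ∀ v ∈ N, v ∉ Subgroup.center G → IsConj v x ∨ IsConj v y ∨ IsConj v w

theorem exists_isIsolatedElement {G : Type*} [Group G] [Finite G] (N : Subgroup G) (hN : N.Normal)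
    (hvertices : Nat.card
      {C : ConjClasses G // C.carrier ⊆ (N : Set G) ∧ 1 < C.carrier.ncard} = 3)
    (hedges : (classGraph N).edgeSet.ncard = 1) : ∃ w, IsIsolatedElement N w := by
  classical
  set V := {C : ConjClasses G // C.carrier ⊆ (N : Set G) ∧ 1 < C.carrier.ncard} with hV
  have : Finite V := Nat.finite_of_card_ne_zero (by omega)
  have := Fintype.ofFinite V
  rw [Nat.card_eq_fintype_card] at hvertices
  have hvertex : ∀ x ∈ N, x ∉ Subgroup.center G → ∃ C : V, C.1 = ConjClasses.mk x := by
    intro x hx hxc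
    refine ⟨⟨ConjClasses.mk x, fun y hy => ?_, ?_⟩, rfl⟩
    · exact (ConjClasses.mk_eq_mk_iff_isConj.1
        (ConjClasses.mem_carrier_iff_mk_eq.1 hy)).symm.mem_of_normal hN hx
    · rw [ConjClasses.ncard_carrier_mk]
      have h1 := mt Subgroup.index_centralizer_singleton_eq_one_iff.1 hxc
      have h0 : (Subgroup.centralizer {x}).index ≠ 0 := Subgroup.index_ne_zero_of_finite
      omega
  have hrep : ∀ C : V, ∃ x ∈ N, x ∉ Subgroup.center G ∧ C.1 = ConjClasses.mk x := by
    rintro ⟨C, hC, hC1⟩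
    obtain ⟨x, rfl⟩ := ConjClasses.mk_surjective C
    refine ⟨x, hC ConjClasses.mem_carrier_mk, fun hx => ?_, rfl⟩
    rw [ConjClasses.ncard_carrier_mk, Subgroup.index_centralizer_singleton_eq_one_iff.2 hx] at hC1
    exact lt_irrefl _ hC1
  have hne : ∀ {C D : V} {x y : G}, C.1 = ConjClasses.mk x → D.1 = ConjClasses.mk y →
      (C ≠ D ↔ ¬ IsConj x y) := by
    intro C D x y hC hD
    rw [Ne, Subtype.ext_iff, hC, hD, ConjClasses.mk_eq_mk_iff_isConj]
  obtain ⟨e, he⟩ := Set.ncard_eq_one.1 hedges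
  induction e using Sym2.ind with
  | _ A B =>
  obtain ⟨C, hC⟩ : ∃ C, C ∉ ({A, B} : Finset V) := by
    by_contra! hall
    have := Finset.card_le_card (fun x _ => hall x : (Finset.univ : Finset V) ⊆ {A, B})
    rw [Finset.card_univ, hvertices] at this
    have := Finset.card_le_two (a := A) (b := B)
    omega
  rw [Finset.mem_insert, Finset.mem_singleton, not_or] at hC
  obtain ⟨w, hwN, hwc, hw⟩ := hrep C
  refine ⟨w, hwN, hwc, ?_, ?_, ?_⟩
  · obtain ⟨u, huN, huc, hu⟩ := hrep A
    exact ⟨u, huN, huc, (hne hu hw).1 (Ne.symm hC.1)⟩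
  · intro x hx hxc hxw
    obtain ⟨D, hD⟩ := hvertex x hx hxc
    by_contra hcop
    have hadj : (classGraph N).Adj D C := by
      refine ⟨(hne hD hw).2 hxw, ?_⟩
      rwa [hD, hw, ConjClasses.ncard_carrier_mk, ConjClasses.ncard_carrier_mk]
    rw [← SimpleGraph.mem_edgeSet, he, Set.mem_singleton_iff, Sym2.eq_iff] at hadj
    rcases hadj with h | h
    · exact hC.2 h.2
    · exact hC.1 h.2
  · intro x hx hxc y hy hyc hxy hxw hyw v hv hvc
    by_contra! hcon
    obtain ⟨X, hX⟩ := hvertex x hx hxc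
    obtain ⟨Y, hY⟩ := hvertex y hy hyc
    obtain ⟨U, hU⟩ := hvertex v hv hvc
    have hcard : ({U, X, Y, C} : Finset V).card = 4 := by
      rw [Finset.card_insert_of_notMem, Finset.card_insert_of_notMem,
        Finset.card_pair ((hne hY hw).2 hyw)]
      · simp only [Finset.mem_insert, Finset.mem_singleton, not_or]
        exact ⟨(hne hX hY).2 hxy, (hne hX hw).2 hxw⟩
      · simp only [Finset.mem_insert, Finset.mem_singleton, not_or]
        exact ⟨(hne hU hX).2 hcon.1, (hne hU hY).2 hcon.2.1, (hne hU hw).2 hcon.2.2⟩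
    have := Finset.card_le_univ ({U, X, Y, C} : Finset V)
    omega

/-! ### Central elements of `G` in `N` -/

namespace IsIsolatedElement

variable {G : Type*} [Group G] {N : Subgroup G} {w : G}

/-- Both elements have the same centralizer, and a class size above 1 is not coprime to itself. -/
theorem isConj_mul (h : IsIsolatedElement N w) {t : G} (htN : t ∈ N)
    (ht : t ∈ Subgroup.center G) : IsConj (t * w) w := by
  by_contra hcon
  have hc := Subgroup.centralizer_singleton_mul_of_mem_center ht w
  have htw : t * w ∉ Subgroup.center G := by
    rw [← Subgroup.index_centralizer_singleton_eq_one_iff, hc,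
      Subgroup.index_centralizer_singleton_eq_one_iff]
    exact h.notMem_center
  have := h.coprime _ (N.mul_mem htN h.mem) htw hcon
  rw [hc, Nat.coprime_self, Subgroup.index_centralizer_singleton_eq_one_iff] at this
  exact h.notMem_center this

theorem not_isConj_mul_self (h : IsIsolatedElement N w) {t u : G} (htN : t ∈ N)
    (ht : t ∈ Subgroup.center G) (huw : ¬ IsConj u w) : ¬ IsConj (t * u) w := by
  intro hcon
  have h1 := (hcon.mul_left_of_mem_center (Subgroup.inv_mem _ ht)).trans
    (h.isConj_mul (N.inv_mem htN) (Subgroup.inv_mem _ ht))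
  rw [inv_mul_cancel_left] at h1
  exact huw h1

variable [Finite G]

/-- Otherwise a prime dividing the order of `t` would divide the class sizes of both `u` and `w`. -/
theorem not_isConj_mul (h : IsIsolatedElement N w) {t u : G} (htN : t ∈ N)
    (ht : t ∈ Subgroup.center G) (ht1 : t ≠ 1) (hu : u ∈ N) (huc : u ∉ Subgroup.center G)
    (huw : ¬ IsConj u w) : ¬ IsConj u (t * u) := by
  intro hcon
  obtain ⟨r, hr, hrt⟩ := Nat.exists_prime_and_dvd (mt orderOf_eq_one_iff.1 ht1)
  obtain ⟨k, hk⟩ := exists_orderOf_pow_eq_of_prime_dvd hr hrt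
  have hkc : t ^ k ∈ Subgroup.center G := Subgroup.pow_mem _ ht k
  have h1 := dvd_index_centralizer_of_isConj_mul hkc (hk ▸ hr) (hcon.pow_mul_of_mem_center ht k)
  have h2 := dvd_index_centralizer_of_isConj_mul hkc (hk ▸ hr)
    ((h.isConj_mul htN ht).symm.pow_mul_of_mem_center ht k)
  rw [hk] at h1 h2
  exact Nat.not_coprime_of_dvd_of_dvd hr.one_lt h1 h2 (h.coprime u hu huc huw)

/-- There is at most one nontrivial element of `N` that is central in `G`. -/
theorem eq_of_mem_center (h : IsIsolatedElement N w) {s t : G} (hsN : s ∈ N)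
    (hs : s ∈ Subgroup.center G) (hs1 : s ≠ 1) (htN : t ∈ N) (ht : t ∈ Subgroup.center G)
    (ht1 : t ≠ 1) : s = t := by
  obtain ⟨u, hu, huc, huw⟩ := h.exists_not_isConj
  rcases h.isConj_or u hu huc (t * u) (N.mul_mem htN hu) (Subgroup.mul_notMem_center ht huc)
    (h.not_isConj_mul htN ht ht1 hu huc huw) huw (h.not_isConj_mul_self htN ht huw)
    (s * u) (N.mul_mem hsN hu) (Subgroup.mul_notMem_center hs huc) with h1 | h1 | h1
  · exact absurd h1.symm (h.not_isConj_mul hsN hs hs1 hu huc huw)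
  · have h2 := h1.mul_left_of_mem_center (Subgroup.inv_mem _ ht)
    rw [inv_mul_cancel_left, ← mul_assoc] at h2
    by_contra hst
    refine h.not_isConj_mul (N.mul_mem (N.inv_mem htN) hsN)
      (Subgroup.mul_mem _ (Subgroup.inv_mem _ ht) hs) (fun e => hst ?_) hu huc huw h2.symm
    exact (inv_mul_eq_one.1 e).symm
  · exact absurd h1 (h.not_isConj_mul_self hsN hs huw)

/-- If `N` contains a nontrivial central element of `G`, then `N` is a `2`-group. -/
theorem isPGroup_two (h : IsIsolatedElement N w) (hN : N.Normal) {t : G} (htN : t ∈ N)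
    (ht : t ∈ Subgroup.center G) (ht1 : t ≠ 1) : IsPGroup 2 N := by
  have htt : t ^ 2 = 1 := by
    by_contra hcon
    have := h.eq_of_mem_center (N.pow_mem htN 2) (Subgroup.pow_mem _ ht 2) hcon htN ht ht1
    rw [pow_two, mul_eq_left] at this
    exact ht1 this
  have hto : orderOf t = 2 := orderOf_eq_prime htt ht1
  have htw := h.isConj_mul htN ht
  have h2w : 2 ∣ (Subgroup.centralizer {w}).index := by
    rw [← hto]
    exact dvd_index_centralizer_of_isConj_mul ht (hto ▸ Nat.prime_two) htw.symm
  -- Conjugating `w` to `t * w` moves `w ^ m` to `t * w ^ m` for odd `m`.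
  have hodd : ∀ m, Odd m → w ^ m ∉ Subgroup.center G := by
    intro m hm hc
    obtain ⟨g, hg⟩ := isConj_iff.1 htw.symm
    have h1 : (t * w) ^ m = t * w ^ m := by
      rw [(show Commute t w from ((Subgroup.mem_center_iff.1 ht) w).symm).mul_pow]
      obtain ⟨j, rfl⟩ := hm
      rw [pow_succ t, pow_mul, htt, one_pow, one_mul]
    rw [← hg, conj_pow, ← (Subgroup.mem_center_iff.1 hc g).symm, mul_inv_cancel_right] at h1
    exact ht1 (mul_eq_right.1 h1.symm)
  refine isPGroup_of_forall_prime_dvd_card fun q hq hqd => ?_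
  by_contra hq2
  have hqodd : Odd q := hq.odd_of_ne_two hq2
  have := Fact.mk hq
  obtain ⟨⟨x, hx⟩, hxq'⟩ := exists_prime_orderOf_dvd_card' q hqd
  have hxq : orderOf x = q := by rwa [← Subgroup.orderOf_coe] at hxq'
  have hxpow : x ^ q = 1 := hxq ▸ pow_orderOf_eq_one x
  have hxw : ¬ IsConj x w := fun hcon =>
    hodd q hqodd (hcon.symm.pow_mem_center (by rw [hxpow]; exact Subgroup.one_mem _))
  have hxc : x ∉ Subgroup.center G := by
    intro hxc
    have hx1 : x ≠ 1 := by
      rintro rfl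
      rw [orderOf_one] at hxq
      exact hq.one_lt.ne hxq
    have := h.eq_of_mem_center hx hxc hx1 htN ht ht1
    exact hq2 (by rw [← hxq, this, hto])
  have hcop := h.coprime x hx hxc hxw
  have h2x : ¬ 2 ∣ (Subgroup.centralizer {x}).index := fun h2 =>
    Nat.not_coprime_of_dvd_of_dvd one_lt_two h2 h2w hcop
  -- With `m` the odd part of the order, `w ^ m` is a noncentral 2-element; as `x` has odd class
  -- size, some conjugate `s` of it commutes with `x`.
  obtain ⟨k, m, hm, hkm⟩ := Nat.exists_eq_two_pow_mul_odd (orderOf_pos w).ne'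
  have hs0 : (w ^ m) ^ 2 ^ k = 1 := by
    rw [← pow_mul, mul_comm, ← hkm, pow_orderOf_eq_one]
  obtain ⟨g, hg⟩ := exists_conj_mem_of_not_dvd_index Nat.prime_two h2x hs0
  set s := g * w ^ m * g⁻¹ with hs
  have hsconj : IsConj (w ^ m) s := isConj_iff.2 ⟨g, rfl⟩
  have hsN : s ∈ N := hN.conj_mem _ (N.pow_mem h.mem m) g
  have hs2 : s ^ 2 ^ k = 1 := by rw [hs, conj_pow, hs0, mul_one, mul_inv_cancel]
  have hcomm : Commute x s := (Subgroup.mem_centralizer_singleton_iff.1 hg).symm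
  have hcops : q.Coprime (orderOf s) :=
    Nat.Coprime.coprime_dvd_right (orderOf_dvd_of_pow_eq_one hs2)
      (Nat.Coprime.pow_right k hqodd.coprime_two_right)
  have hsq : s ^ q ∉ Subgroup.center G := by
    intro hc
    obtain ⟨j, hj⟩ := exists_pow_eq_self_of_coprime hcops
    have hsc : s ^ 1 ∈ Subgroup.center G := by
      rw [pow_one, ← hj]
      exact Subgroup.pow_mem _ hc j
    have := hsconj.pow_mem_center hsc
    rw [pow_one] at this
    exact hodd m hm this
  have hxsq : (x * s) ^ q = s ^ q := by rw [hcomm.mul_pow, hxpow, one_mul]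
  have hxsc : x * s ∉ Subgroup.center G := fun hc =>
    hsq (hxsq ▸ Subgroup.pow_mem _ hc q)
  -- The `q`-th powers of `x` and `t * x` are central, unlike that of `x * s`; and `x * s` conjugate
  -- to `w` would make the class size of `x` divide that of `w`.
  rcases h.isConj_or x hx hxc (t * x) (N.mul_mem htN hx) (Subgroup.mul_notMem_center ht hxc)
    (h.not_isConj_mul htN ht ht1 hx hxc hxw) hxw (h.not_isConj_mul_self htN ht hxw)
    (x * s) (N.mul_mem hx hsN) hxsc with h1 | h1 | h1
  · refine hsq (hxsq ▸ h1.pow_mem_center ?_)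
    rw [hxpow]
    exact Subgroup.one_mem _
  · refine hsq (hxsq ▸ h1.pow_mem_center ?_)
    rw [(show Commute t x from ((Subgroup.mem_center_iff.1 ht) x).symm).mul_pow, hxpow, mul_one]
    exact Subgroup.pow_mem _ ht q
  · have hdvd := Subgroup.index_dvd_of_le (centralizer_mul_le_of_coprime hcomm (hxq ▸ hcops))
    rw [Subgroup.index_centralizer_singleton_eq_of_isConj h1] at hdvd
    exact hxc (Subgroup.index_centralizer_singleton_eq_one_iff.1
      (Nat.eq_one_of_dvd_coprimes hcop dvd_rfl hdvd))

/-! ### Trivial intersection with the centre -/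

/-- If `x` were conjugate to `w`, the class size of `w` would divide that of `x * y`, whose order is
too large for it to be conjugate to `w`. -/
theorem not_isConj_of_commute (h : IsIsolatedElement N w)
    (hZ : ∀ x ∈ N, x ∈ Subgroup.center G → x = 1) {x y : G} (hx : x ∈ N) (hy : y ∈ N)
    (hx1 : x ≠ 1) (hy1 : y ≠ 1) (hxy : Commute x y) (hcop : (orderOf x).Coprime (orderOf y)) :
    x * y ∉ Subgroup.center G ∧ ¬ IsConj x y ∧ ¬ IsConj x w := by
  have hxo := mt orderOf_eq_one_iff.1 hx1
  have hyo := mt orderOf_eq_one_iff.1 hy1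
  have hmul := hxy.orderOf_mul_eq_mul_orderOf_of_coprime hcop
  have hxyc : x * y ∉ Subgroup.center G := by
    intro hc
    rw [hZ _ (N.mul_mem hx hy) hc, orderOf_one] at hmul
    exact hxo (Nat.eq_one_of_mul_eq_one_right hmul.symm)
  refine ⟨hxyc, fun hcon => ?_, fun hcon => ?_⟩
  · rw [hcon.orderOf_eq, Nat.coprime_self] at hcop
    exact hyo hcop
  · have hxyw : ¬ IsConj (x * y) w := by
      intro h1
      have := (h1.trans hcon.symm).orderOf_eq
      rw [hmul] at this
      exact hyo ((Nat.mul_eq_left (orderOf_pos x).ne').1 this)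
    have h2 := h.coprime _ (N.mul_mem hx hy) hxyc hxyw
    have hdvd := Subgroup.index_dvd_of_le (centralizer_mul_le_of_coprime hxy hcop)
    rw [Subgroup.index_centralizer_singleton_eq_of_isConj hcon] at hdvd
    exact h.notMem_center (Subgroup.index_centralizer_singleton_eq_one_iff.1
      (Nat.eq_one_of_dvd_coprimes h2 hdvd dvd_rfl))

/-- If `N` meets the center trivially, then nontrivial elements of `N` of coprime orders do not
commute. -/
theorem not_commute (h : IsIsolatedElement N w)
    (hZ : ∀ x ∈ N, x ∈ Subgroup.center G → x = 1) {x y : G} (hx : x ∈ N) (hy : y ∈ N)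
    (hx1 : x ≠ 1) (hy1 : y ≠ 1) (hcop : (orderOf x).Coprime (orderOf y)) : ¬ Commute x y := by
  intro hxy
  have hxc : x ∉ Subgroup.center G := fun hc => hx1 (hZ x hx hc)
  have hyc : y ∉ Subgroup.center G := fun hc => hy1 (hZ y hy hc)
  have hmul := hxy.orderOf_mul_eq_mul_orderOf_of_coprime hcop
  obtain ⟨hxyc, hne, hxw⟩ := h.not_isConj_of_commute hZ hx hy hx1 hy1 hxy hcop
  obtain ⟨-, -, hyw⟩ := h.not_isConj_of_commute hZ hy hx hy1 hx1 hxy.symm hcop.symm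
  rcases h.isConj_or x hx hxc y hy hyc hne hxw hyw _ (N.mul_mem hx hy) hxyc with h1 | h1 | h1
  · have := h1.orderOf_eq
    rw [hmul] at this
    exact hy1 (orderOf_eq_one_iff.1 ((Nat.mul_eq_left (orderOf_pos x).ne').1 this))
  · have := h1.orderOf_eq
    rw [hmul] at this
    exact hx1 (orderOf_eq_one_iff.1 ((Nat.mul_eq_right (orderOf_pos y).ne').1 this))
  · have hdvd := Subgroup.index_dvd_of_le (centralizer_mul_le_of_coprime hxy hcop)
    rw [Subgroup.index_centralizer_singleton_eq_of_isConj h1] at hdvd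
    exact hxc (Subgroup.index_centralizer_singleton_eq_one_iff.1
      (Nat.eq_one_of_dvd_coprimes (h.coprime x hx hxc hxw) dvd_rfl hdvd))

/-- If `N` meets the center trivially, then centralizers in `N` have prime power order. -/
theorem exists_card_centralizer_eq_pow (h : IsIsolatedElement N w)
    (hZ : ∀ x ∈ N, x ∈ Subgroup.center G → x = 1) {x : N} {p : ℕ} (hp : p.Prime)
    (hpx : p ∣ orderOf x) : ∃ i, Nat.card (Subgroup.centralizer {x}) = p ^ i := by
  refine ⟨_, Nat.eq_prime_pow_of_unique_prime_dvd Nat.card_pos.ne' fun {r} hr hrd => ?_⟩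
  by_contra hrp
  have := Fact.mk hr
  obtain ⟨⟨y, hyc⟩, hyr'⟩ := exists_prime_orderOf_dvd_card' r hrd
  have hyr : orderOf (y : G) = r := by rwa [← Subgroup.orderOf_coe, ← Subgroup.orderOf_coe] at hyr'
  obtain ⟨k, hk'⟩ := exists_orderOf_pow_eq_of_prime_dvd hp hpx
  have hk : orderOf ((x : G) ^ k) = p := by rwa [← Subgroup.orderOf_coe] at hk'
  have hcomm : Commute (x : G) (y : G) :=
    (congrArg Subtype.val (Subgroup.mem_centralizer_singleton_iff.1 hyc)).symm
  refine h.not_commute hZ (N.pow_mem x.2 k) y.2 ?_ ?_ ?_ (hcomm.pow_left k)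
  · rw [Ne, ← orderOf_eq_one_iff, hk]
    exact hp.one_lt.ne'
  · rw [Ne, ← orderOf_eq_one_iff, hyr]
    exact hr.one_lt.ne'
  · rw [hk, hyr]
    exact (Nat.coprime_primes hp hr).2 (Ne.symm hrp)

/-- The centralizer in `N` is a `p`-group, so `r` divides the `N`-class size, hence the `G`-class
size. -/
theorem dvd_index_centralizer (h : IsIsolatedElement N w) (hN : N.Normal)
    (hZ : ∀ x ∈ N, x ∈ Subgroup.center G → x = 1) {x : N} {p r : ℕ} (hp : p.Prime)
    (hpx : p ∣ orderOf x) (hr : r.Prime) (hrp : r ≠ p) (hrN : r ∣ Nat.card N) :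
    r ∣ (Subgroup.centralizer {(x : G)}).index := by
  obtain ⟨i, hi⟩ := h.exists_card_centralizer_eq_pow hZ hp hpx
  rw [← Subgroup.card_mul_index (Subgroup.centralizer {x}), hi] at hrN
  exact (Nat.Coprime.dvd_of_dvd_mul_left
    (Nat.Coprime.pow_right i ((Nat.coprime_primes hr hp).2 hrp)) hrN).trans
    (index_centralizer_coe_dvd hN x)

theorem card_centralizer_eq (h : IsIsolatedElement N w) (hN : N.Normal)
    (hZ : ∀ x ∈ N, x ∈ Subgroup.center G → x = 1) {x : N} {p a m : ℕ} (hp : p.Prime)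
    (hpx : p ∣ orderOf x) (hcard : Nat.card N = p ^ a * m) (hm : ¬ p ∣ m)
    (hind : ¬ p ∣ (Subgroup.centralizer {(x : G)}).index) :
    Nat.card (Subgroup.centralizer {x}) = p ^ a := by
  obtain ⟨i, hi⟩ := h.exists_card_centralizer_eq_pow hZ hp hpx
  have h1 := Subgroup.card_mul_index (Subgroup.centralizer {x})
  have h2 : ¬ p ∣ (Subgroup.centralizer {x}).index := fun hd =>
    hind (hd.trans (index_centralizer_coe_dvd hN x))
  rw [hcard] at h1
  have hcop : ∀ {j n}, ¬ p ∣ n → (p ^ j).Coprime n := fun hn =>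
    Nat.Coprime.pow_left _ ((Nat.Prime.coprime_iff_not_dvd hp).2 hn)
  refine Nat.dvd_antisymm ?_ ?_
  · rw [hi] at h1 ⊢
    exact (hcop hm).dvd_of_dvd_mul_right ⟨_, h1.symm⟩
  · exact (hcop h2).dvd_of_dvd_mul_right ⟨m, h1⟩

/-- If `N` meets the center trivially, then `N` is a `p`-group or a Frobenius `{p, q}`-group. -/
theorem isPGroup_or_isFrobeniusWith (h : IsIsolatedElement N w) (hN : N.Normal)
    (hZ : ∀ x ∈ N, x ∈ Subgroup.center G → x = 1) :
    ∃ p q : ℕ, p.Prime ∧ q.Prime ∧ p ≠ q ∧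
      (∀ r : ℕ, r.Prime → r ∣ Nat.card N → r = p ∨ r = q) ∧
      (IsPGroup p N ∨ ∃ K H : Subgroup N, IsQuasiFrobeniusWith K H ∧
        IsMulCommutative K ∧ IsMulCommutative H) := by
  lift w to N using h.mem
  have hw1 : w ≠ 1 := by
    rintro rfl
    exact h.notMem_center (Subgroup.one_mem _)
  obtain ⟨q, hq, hqw⟩ := Nat.exists_prime_and_dvd (mt orderOf_eq_one_iff.1 hw1)
  have hqN : q ∣ Nat.card N := hqw.trans (orderOf_dvd_natCard w)
  by_cases hall : ∀ r : ℕ, r.Prime → r ∣ Nat.card N → r = q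
  · obtain ⟨p, hpq, hp⟩ := Nat.exists_infinite_primes (q + 1)
    exact ⟨q, p, hq, hp, by omega, fun r hr hrN => Or.inl (hall r hr hrN),
      Or.inl (isPGroup_of_forall_prime_dvd_card hall)⟩
  push Not at hall
  obtain ⟨p, hp, hpN, hpq⟩ := hall
  have hnc : ∀ x : N, x ≠ 1 → (x : G) ∉ Subgroup.center G := fun x hx hc =>
    hx (Subtype.ext (hZ x x.2 hc))
  have hconj : ∀ (x y : N) (r s : ℕ), r.Prime → s.Prime → r ≠ s → r ∣ orderOf x →
      s ∣ orderOf y → ¬ IsConj (x : G) y := by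
    intro x y r s hr hs hrs hrx hsy hcon
    have ho := hcon.orderOf_eq
    rw [Subgroup.orderOf_coe, Subgroup.orderOf_coe] at ho
    obtain ⟨i, hi⟩ := h.exists_card_centralizer_eq_pow hZ hr hrx
    have hxc : x ∈ Subgroup.centralizer {x} := Subgroup.mem_centralizer_singleton_iff.2 rfl
    have hd := hi ▸ Subgroup.orderOf_dvd_natCard _ hxc
    rw [← ho] at hsy
    exact hrs ((Nat.prime_dvd_prime_iff_eq hs hr).1 (hs.dvd_of_dvd_pow (hsy.trans hd))).symm
  have hne1 : ∀ (x : N) (r : ℕ), r.Prime → r ∣ orderOf x → x ≠ 1 := by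
    rintro x r hr hrx rfl
    rw [orderOf_one] at hrx
    exact hr.one_lt.ne' (Nat.dvd_one.1 hrx)
  have := Fact.mk hp
  obtain ⟨x₀, hx₀⟩ := exists_prime_orderOf_dvd_card' p hpN
  have hpx₀ : p ∣ orderOf x₀ := hx₀.symm.dvd
  have hcopp : ∀ x : N, p ∣ orderOf x → (Subgroup.centralizer {(x : G)}).index.Coprime
      (Subgroup.centralizer {(w : G)}).index := fun x hpx =>
    h.coprime x x.2 (hnc x (hne1 x p hp hpx)) (hconj x w p q hp hq hpq hpx hqw)
  have hprimes : ∀ r : ℕ, r.Prime → r ∣ Nat.card N → r = p ∨ r = q := by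
    intro r hr hrN
    by_contra! hcon
    -- A third prime would divide the class sizes of both `x₀` and `w`.
    exact Nat.not_coprime_of_dvd_of_dvd hr.one_lt
      (h.dvd_index_centralizer hN hZ hp hpx₀ hr hcon.1 hrN)
      (h.dvd_index_centralizer hN hZ hq hqw hr hcon.2 hrN) (hcopp x₀ hpx₀)
  have hpw : p ∣ (Subgroup.centralizer {(w : G)}).index :=
    h.dvd_index_centralizer hN hZ hq hqw hp hpq hpN
  refine ⟨p, q, hp, hq, hpq, hprimes, Or.inr ?_⟩
  obtain ⟨a, m, hpm, hm⟩ := Nat.exists_eq_pow_mul_and_not_dvd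
    (Nat.card_pos (α := N)).ne' p hp.ne_one
  have hm0 : m ≠ 0 := by
    rintro rfl
    exact hpm (dvd_zero p)
  obtain ⟨b, rfl⟩ : ∃ b, m = q ^ b := ⟨_, Nat.eq_prime_pow_of_unique_prime_dvd hm0
    fun {r} hr hrm => (hprimes r hr (hm ▸ hrm.mul_left _)).resolve_left
      (by rintro rfl; exact hpm hrm)⟩
  have hqp : ¬ q ∣ p ^ a := fun hd =>
    hpq ((Nat.prime_dvd_prime_iff_eq hq hp).1 (hq.dvd_of_dvd_pow hd)).symm
  have ha : a ≠ 0 := by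
    rintro rfl
    rw [pow_zero, one_mul] at hm
    exact hpm (hm ▸ hpN)
  have hb : b ≠ 0 := by
    rintro rfl
    rw [pow_zero, mul_one] at hm
    exact hqp (hm ▸ hqN)
  have hcent : ∀ x : N, x ≠ 1 → Nat.card (Subgroup.centralizer {x}) = p ^ a ∨
      Nat.card (Subgroup.centralizer {x}) = q ^ b := by
    intro x hx1
    obtain ⟨r, hr, hrx⟩ := Nat.exists_prime_and_dvd (mt orderOf_eq_one_iff.1 hx1)
    rcases hprimes r hr (hrx.trans (orderOf_dvd_natCard x)) with rfl | rfl
    · exact Or.inl (h.card_centralizer_eq hN hZ hr hrx hm hpm fun hd =>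
        Nat.not_coprime_of_dvd_of_dvd hr.one_lt hd hpw (hcopp x hrx))
    · refine Or.inr (h.card_centralizer_eq hN hZ hr hrx (hm.trans (mul_comm _ _)) hqp fun hd => ?_)
      -- Otherwise `p` divides two coprime class sizes. The size for `w` is prime to `q`, which
      -- divides that for `x₀`.
      have hxw : IsConj (x : G) w := by
        by_contra hcon
        exact Nat.not_coprime_of_dvd_of_dvd hp.one_lt
          (h.dvd_index_centralizer hN hZ hr hrx hp hpq hpN) hpw (h.coprime x x.2 (hnc x hx1) hcon)
      rw [Subgroup.index_centralizer_singleton_eq_of_isConj hxw] at hd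
      exact Nat.not_coprime_of_dvd_of_dvd hr.one_lt
        (h.dvd_index_centralizer hN hZ hp hpx₀ hr hpq.symm hqN) hd (hcopp x₀ hpx₀)
  obtain ⟨K, H, hF, hK, hH⟩ := exists_isFrobeniusWith hp hq hpq ha hb hm hcent
  refine ⟨K, H, hF.isQuasiFrobeniusWith ((Subgroup.eq_bot_iff_forall _).2 fun x hx => ?_), hK, hH⟩
  by_contra hx1
  have htop := Subgroup.card_mul_index (Subgroup.centralizer {x})
  rw [Subgroup.index_centralizer_singleton_eq_one_iff.2 hx, mul_one, hm] at htop
  have hpa := Nat.one_lt_pow ha hp.one_lt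
  have hqb := Nat.one_lt_pow hb hq.one_lt
  rcases hcent x hx1 with h1 | h1 <;> rw [h1] at htop <;> nlinarith

end IsIsolatedElement

/-! ### Conclusion -/

theorem theorem5p1p1 {G : Type*} [Group G] [Finite G] (N : Subgroup G) (hN : N.Normal)
    (hvertices : Nat.card
      {C : ConjClasses G // C.carrier ⊆ (N : Set G) ∧ 1 < C.carrier.ncard} = 3)
    (hedges : (classGraph N).edgeSet.ncard = 1) :
    ∃ p q : ℕ, p.Prime ∧ q.Prime ∧ p ≠ q ∧
      (∀ r : ℕ, r.Prime → r ∣ Nat.card N → r = p ∨ r = q) ∧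
      (IsPGroup p N ∨
        ((∃ K H : Subgroup N, IsQuasiFrobeniusWith K H ∧
            IsMulCommutative K ∧ IsMulCommutative H) ∧
          (Nat.card (N ⊓ Subgroup.center G : Subgroup G) = 1 ∨
            Nat.card (N ⊓ Subgroup.center G : Subgroup G) = 2))) := by
  obtain ⟨w, hw⟩ := exists_isIsolatedElement N hN hvertices hedges
  by_cases hZ : ∀ x ∈ N, x ∈ Subgroup.center G → x = 1
  · obtain ⟨p, q, hp, hq, hpq, hprimes, h⟩ := hw.isPGroup_or_isFrobeniusWith hN hZ
    refine ⟨p, q, hp, hq, hpq, hprimes, h.imp_right fun h => ⟨h, Or.inl ?_⟩⟩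
    rw [Subgroup.card_eq_one, Subgroup.eq_bot_iff_forall]
    exact fun x hx => hZ x hx.1 hx.2
  · push Not at hZ
    obtain ⟨t, htN, ht, ht1⟩ := hZ
    have h2 := hw.isPGroup_two hN htN ht ht1
    refine ⟨2, 3, Nat.prime_two, Nat.prime_three, by norm_num, fun r hr hrN => Or.inl ?_, Or.inl h2⟩
    have := Fact.mk Nat.prime_two
    obtain ⟨n, hn⟩ := IsPGroup.iff_card.1 h2
    exact (Nat.prime_dvd_prime_iff_eq hr Nat.prime_two).1 (hr.dvd_of_dvd_pow (hn ▸ hrN))
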